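/- Let $\Sigma$ be a finite alphabet and let $\mathcal M$ be a finite connected Markov chain whose states are labelled by letters: a finite state set $Q$, an initial distribution $\pi$ on $Q$, transition probabilities $p(q,r)$ such that every state can be reached from every other state through transitions of positive probability, and a labelling $\lambda : Q \to \Sigma$. Let $(X_i)_{i\ge 1}$ be $\mathit{Markov}(\mathcal M)$, i.e. a random state sequence with $\mathbb P(X_1=q_1,\dots,X_n=q_n)=\pi(q_1)\prod_{i<n}p(q_i,q_{i+1})$, and let $w=\lambda(X_1)\lambda(X_2)\cdots$ be the random infinite word that it emits; $w_{..n}$ is its prefix of length $n$ and $|u|_\sigma$ is the number of occurrences of $\sigma$ in $u$. For a state $q$ let $f_q = 1/m_q$, where $m_q$ is the expected return time to $q$, and for a letter $\sigma$ let $f_\sigma=\sum_{q:\lambda(q)=\sigma} f_q$ be its limit frequency. The mode statistic maps a finite word $u$ to the letter $a$ with $|u|_a>|u|_b$ for all $b\ne a$ if there is one, and is undefined (a separate value) otherwise. It converges to $a$ on an infinite word $w$ if there is an $n$ such that the mode of $w_{..n'}$ is $a$ for all $n'\ge n$; it converges to $a$ over $\mathcal M$ if it converges to $a$ on $w$ almost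 surely. **Theorem.** (i) For every letter $a\in\Sigma$, the mode statistic converges to $a$ over $\mathcal M$ if and only if $f_a > f_b$ for all $b\neq a$. (ii) If there are two distinct letters $a,a'$ with equal maximal frequencies $f_a=f_{a'}\ge f_b$ for all $b \in \Sigma$, then almost surely the value of the mode statistic on $w_{..n}$ (a letter or undefined) changes infinitely often as $n\to\infty$, and the mode statistic converges on $w$ to no letter, i.e. $w$ has no mode. -/

import Mathlib

open MeasureTheory ProbabilityTheory
open scoped ENNReal

/-- A statistic over the alphabet `A` maps every finite word to an output value. -/
abbrev Statistic (A O : Type*) := List A → O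

/-- The prefix of length `n` of an infinite word (whose letters are indexed from `0`). -/
def wordPrefix {A : Type*} (w : ℕ → A) (n : ℕ) : List A := (List.range n).map w

/-- The statistic `μ` converges to the value `v` on the infinite word `w`:
all sufficiently long prefixes of `w` are mapped to `v`. -/
def Statistic.ConvergesOn {A O : Type*} (μ : Statistic A O) (w : ℕ → A) (v : O) : Prop :=
  ∃ n, ∀ n' ≥ n, μ (wordPrefix w n') = v

open Classical in
/-- The letter `a` is the mode of the finite word `u`: it occurs strictly more often
than every other letter. -/
def IsMode {A : Type*} (u : List A) (a : A) : Prop :=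
  ∀ b, b ≠ a → u.count b < u.count a

open Classical in
/-- The mode statistic: `some a` if `a` is the (necessarily unique) mode of the word,
and `none` if the word has no mode. -/
noncomputable def modeStatistic (A : Type*) : Statistic A (Option A) := fun u =>
  if h : ∃ a, IsMode u a then some h.choose else none

/-- A Markov chain with state space `Q` whose states are labelled by letters from `A`. -/
structure MarkovChain (Q A : Type*) where
  /-- the initial distribution -/
  init : PMF Q
  /-- the transition probabilities -/
  trans : Q → PMF Q
  /-- the letter that is emitted in a state -/
  label : Q → A

namespace MarkovChain

variable {Q A : Type*} (M : MarkovChain Q A)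

/-- Every state can be reached from every other state through transitions of positive
probability. -/
def Connected : Prop :=
  ∀ q r : Q, Relation.ReflTransGen (fun s t => M.trans s t ≠ 0) q r

/-- The random sequence of states `X` is `Markov(M)` under `P`: its finite-dimensional
distributions are given by the initial distribution and the transition probabilities. -/
structure IsMarkov [MeasurableSpace Q] {Ω : Type*} [MeasurableSpace Ω]
    (P : Measure Ω) (X : ℕ → Ω → Q) : Prop where
  measurable : ∀ i, Measurable (X i)
  law : ∀ (n : ℕ) (x : ℕ → Q),
    P {ω | ∀ i ≤ n, X i ω = x i} =
      M.init (x 0) * ∏ i ∈ Finset.range n, M.trans (x i) (x (i + 1))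

section Frequencies

variable [Finite Q] [MeasurableSpace Q] [DiscreteMeasurableSpace Q]

/-- The transition probabilities of the chain as a Markov kernel. -/
noncomputable def transKernel : Kernel Q Q :=
  Kernel.ofFunOfCountable fun q => (M.trans q).toMeasure

instance : IsMarkovKernel M.transKernel :=
  ⟨fun q => PMF.toMeasure.isProbabilityMeasure (M.trans q)⟩

/-- The law of the next state given the history up to time `n`; it depends on the state at
time `n` only. -/
noncomputable def stepKernel (n : ℕ) : Kernel ((i : Finset.Iic n) → (fun _ : ℕ => Q) i) Q :=
  M.transKernel.comap (fun h => h ⟨n, Finset.mem_Iic.2 le_rfl⟩) (measurable_pi_apply _)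

instance (n : ℕ) : IsMarkovKernel (M.stepKernel n) :=
  inferInstanceAs (IsMarkovKernel (M.transKernel.comap _ _))

/-- The law on the space of infinite state sequences of the chain that starts in state `q`. -/
noncomputable def pathMeasure (q : Q) : Measure (ℕ → Q) :=
  Kernel.trajMeasure (X := fun _ => Q) (Measure.dirac q) M.stepKernel

end Frequencies

/-- The first positive time at which the state sequence `x` is in state `q` (`∞` if there is
no such time). -/
noncomputable def returnTime (q : Q) (x : ℕ → Q) : ℝ≥0∞ :=
  ⨅ (n : ℕ) (_ : 1 ≤ n ∧ x n = q), (n : ℝ≥0∞)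

/-- The expected return time `m_q` of the chain that starts in state `q`. -/
noncomputable def expectedReturnTime [Finite Q] [MeasurableSpace Q]
    [DiscreteMeasurableSpace Q] (q : Q) : ℝ≥0∞ :=
  ∫⁻ x, returnTime q x ∂(M.pathMeasure q)

/-- The limit frequency `f_q` of state `q`, the inverse of its expected return time. -/
noncomputable def stateFreq [Finite Q] [MeasurableSpace Q]
    [DiscreteMeasurableSpace Q] (q : Q) : ℝ :=
  (M.expectedReturnTime q)⁻¹.toReal

open Classical in
/-- The limit frequency `f_a` of letter `a`, the sum of the frequencies of the states that
are labelled by `a`. -/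
noncomputable def letterFreq [Fintype Q] [MeasurableSpace Q]
    [DiscreteMeasurableSpace Q] (a : A) : ℝ :=
  ∑ q with M.label q = a, M.stateFreq q

/-- The infinite random word emitted by the random sequence of states `X`. -/
def word {Ω : Type*} (X : ℕ → Ω → Q) (ω : Ω) : ℕ → A := fun i => M.label (X i ω)

/-- Over the Markov chain `M`, whose random state sequence is `X`, the statistic `μ`
converges (almost surely) to the value `v`. -/
def StatisticConverges {Ω O : Type*} [MeasurableSpace Ω] (P : Measure Ω) (X : ℕ → Ω → Q)
    (μ : Statistic A O) (v : O) : Prop :=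
  ∀ᵐ ω ∂P, μ.ConvergesOn (M.word X ω) v

end MarkovChain

/-! The letter `a` is the mode of a prefix exactly when, for every `b ≠ a`, the partial sum along
the chain of the function `letterDiff a b` is positive; its mean under the state frequencies is `f_a
- f_b`. So everything reduces to the sign of sums `S_n` of a function `g` with mean `m`.

Neither an ergodic theorem nor a stationary distribution is needed, because the Poisson equation `g
+ p h - h = m` can be solved explicitly (`Connected.exists_poisson`): for the indicator of `q`, take
`h = -f_q` times the expected hitting time of `q`. Then `S_n + h(X_n) - n m` is a martingale with
bounded increments.

If `m > 0`, an exponential moment bound and summability make `S_n` eventually positive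
(`IsMarkov.ae_eventually_sum_pos`). If `m ≤ 0`, an eventually positive `S_n` would force the
martingale to converge; recurrence then makes it constant, and `S_n = n m ≤ 0` at returns to the
initial state (`IsMarkov.ae_frequently_sum_nonpos`). Ties are thus covered by the second case.

That the value keeps changing is combinatorial: over a finite alphabet prefixes with a mode recur
(`exists_ge_isMode`), so an eventually constant value would be a letter. -/

namespace MarkovChain

/-! ### One-step laws and conditional expectations given the history -/

/-- The history up to time `n` of a sequence of states. -/
def hist {Q Ω : Type*} (X : ℕ → Ω → Q) (n : ℕ) (ω : Ω) : Finset.Iic n → Q := fun i => X i ω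

/-- The last state of a history. -/
def last {Q : Type*} {n : ℕ} (h : Finset.Iic n → Q) : Q := h ⟨n, Finset.mem_Iic.2 le_rfl⟩

/-- The transition probabilities as real numbers. -/
noncomputable def prob {Q A : Type*} (M : MarkovChain Q A) (q r : Q) : ℝ := (M.trans q r).toReal

variable {Q A Ω : Type*} (M : MarkovChain Q A)

theorem prob_nonneg (q r : Q) : 0 ≤ M.prob q r := ENNReal.toReal_nonneg

theorem sum_trans [Fintype Q] (q : Q) : ∑ r, M.trans q r = 1 := by
  exact (tsum_fintype _).symm.trans (M.trans q).tsum_coe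

theorem sum_prob [Fintype Q] (q : Q) : ∑ r, M.prob q r = 1 := by
  unfold prob
  rw [← ENNReal.toReal_sum fun r _ => (M.trans q).apply_ne_top r, M.sum_trans, ENNReal.toReal_one]

theorem prob_pos {q r : Q} (h : M.trans q r ≠ 0) : 0 < M.prob q r :=
  ENNReal.toReal_pos h ((M.trans q).apply_ne_top r)

variable [MeasurableSpace Q] [MeasurableSpace Ω]
  {M} {P : Measure Ω} {X : ℕ → Ω → Q}

theorem measurable_hist (hX : M.IsMarkov P X) (n : ℕ) : Measurable (hist X n) :=
  measurable_pi_lambda _ fun i => hX.measurable i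

theorem IsMarkov.law_succ (hX : M.IsMarkov P X) (n : ℕ) (h : Finset.Iic n → Q) (r : Q) :
    P {ω | hist X n ω = h ∧ X (n + 1) ω = r} =
      P {ω | hist X n ω = h} * M.trans (last h) r := by
  set x : ℕ → Q := fun i => if hi : i ≤ n then h ⟨i, Finset.mem_Iic.2 hi⟩ else r with hx
  have h1 : ∀ ω, hist X n ω = h ↔ ∀ i ≤ n, X i ω = x i := by
    intro ω
    constructor
    · rintro rfl i hi
      simp [hx, hi, hist]
    · intro H
      ext ⟨i, hi⟩
      have := H i (Finset.mem_Iic.1 hi)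
      simpa [hx, Finset.mem_Iic.1 hi, hist] using this
  have h2 : ∀ ω, (hist X n ω = h ∧ X (n + 1) ω = r) ↔ ∀ i ≤ n + 1, X i ω = x i := by
    intro ω
    rw [h1]
    constructor
    · rintro ⟨H, H'⟩ i hi
      rcases Nat.le_succ_iff.1 hi with hi | rfl
      · exact H i hi
      · simp [hx, H']
    · intro H
      refine ⟨fun i hi => H i (by omega), ?_⟩
      simpa [hx] using H (n + 1) le_rfl
  simp_rw [h2, h1]
  rw [hX.law, hX.law, Finset.prod_range_succ, ← mul_assoc]
  congr 2
  · simp [hx, last]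
  · simp [hx]

variable [Fintype Q] [DiscreteMeasurableSpace Q]

/-- Histories range over a finite type, so both sides become finite sums over pairs of a history and
a next state, matched by `law_succ`. Dependence of `Φ` on the whole history is what later allows
partial sums and avoidance events. -/
theorem IsMarkov.lintegral_step (hX : M.IsMarkov P X) (n : ℕ)
    (Φ : (Finset.Iic n → Q) → Q → ℝ≥0∞) :
    ∫⁻ ω, Φ (hist X n ω) (X (n + 1) ω) ∂P =
      ∫⁻ ω, ∑ r, M.trans (X n ω) r * Φ (hist X n ω) r ∂P := by
  have e1 := lintegral_map (μ := P) (f := fun z : (Finset.Iic n → Q) × Q => Φ z.1 z.2)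
    (g := fun ω => (hist X n ω, X (n + 1) ω)) (measurable_of_countable _)
    ((measurable_hist hX n).prodMk (hX.measurable (n + 1)))
  have e2 := lintegral_map (μ := P)
    (f := fun z : (Finset.Iic n → Q) => ∑ r, M.trans (last z) r * Φ z r)
    (g := hist X n) (measurable_of_countable _) (measurable_hist hX n)
  refine e1.symm.trans (Eq.trans ?_ e2)
  rw [lintegral_fintype, lintegral_fintype, Fintype.sum_prod_type]
  refine Finset.sum_congr rfl fun h _ => ?_
  rw [Finset.sum_mul]
  refine Finset.sum_congr rfl fun r _ => ?_
  rw [Measure.map_apply ((measurable_hist hX n).prodMk (hX.measurable (n + 1)))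
    (measurableSet_singleton _), Measure.map_apply (measurable_hist hX n)
    (measurableSet_singleton _)]
  have := hX.law_succ n h r
  have e3 : (fun ω => (hist X n ω, X (n + 1) ω)) ⁻¹' {(h, r)} =
    {ω | hist X n ω = h ∧ X (n + 1) ω = r} := by ext; simp
  have e4 : hist X n ⁻¹' {h} = {ω | hist X n ω = h} := by ext; simp
  rw [e3, e4, this]
  ring

theorem IsMarkov.integral_step [IsFiniteMeasure P] (hX : M.IsMarkov P X) (n : ℕ)
    (Φ : (Finset.Iic n → Q) → Q → ℝ) :
    ∫ ω, Φ (hist X n ω) (X (n + 1) ω) ∂P =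
      ∫ ω, ∑ r, M.prob (X n ω) r * Φ (hist X n ω) r ∂P := by
  have m1 := (measurable_hist hX n).prodMk (hX.measurable (n + 1))
  have e1 := integral_map (μ := P) (f := fun z : (Finset.Iic n → Q) × Q => Φ z.1 z.2)
    (φ := fun ω => (hist X n ω, X (n + 1) ω)) m1.aemeasurable
    (measurable_of_countable _).aestronglyMeasurable
  have e2 := integral_map (μ := P)
    (f := fun z : (Finset.Iic n → Q) => ∑ r, M.prob (last z) r * Φ z r)
    (φ := hist X n) (measurable_hist hX n).aemeasurable
    (measurable_of_countable _).aestronglyMeasurable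
  refine e1.symm.trans (Eq.trans ?_ e2)
  rw [integral_fintype .of_finite, integral_fintype .of_finite, Fintype.sum_prod_type]
  refine Finset.sum_congr rfl fun h _ => ?_
  rw [Finset.smul_sum]
  refine Finset.sum_congr rfl fun r _ => ?_
  rw [Measure.real, Measure.real, Measure.map_apply m1
    (measurableSet_singleton _), Measure.map_apply (measurable_hist hX n)
    (measurableSet_singleton _)]
  have := hX.law_succ n h r
  have e3 : (fun ω => (hist X n ω, X (n + 1) ω)) ⁻¹' {(h, r)} =
    {ω | hist X n ω = h ∧ X (n + 1) ω = r} := by ext; simp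
  have e4 : hist X n ⁻¹' {h} = {ω | hist X n ω = h} := by ext; simp
  rw [e3, e4, this, ENNReal.toReal_mul, prob, smul_eq_mul, smul_eq_mul]
  ring

/-- The filtration generated by the histories. -/
def IsMarkov.filtration (hX : M.IsMarkov P X) : Filtration ℕ ‹MeasurableSpace Ω› where
  seq n := MeasurableSpace.comap (hist X n) inferInstance
  mono' m n hmn := by
    rw [← measurable_iff_comap_le]
    exact (measurable_pi_lambda (fun (h : Finset.Iic n → Q) (i : Finset.Iic m) =>
      h ⟨i, Finset.mem_Iic.2 ((Finset.mem_Iic.1 i.2).trans hmn)⟩)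
      fun i => measurable_pi_apply _).comp (comap_measurable (hist X n))
  le' n := measurable_iff_comap_le.1 (measurable_hist hX n)

theorem IsMarkov.stronglyMeasurable_hist (hX : M.IsMarkov P X) (n : ℕ)
    (φ : (Finset.Iic n → Q) → ℝ) :
    StronglyMeasurable[hX.filtration n] fun ω => φ (hist X n ω) :=
  ((measurable_of_countable φ).comp (comap_measurable (hist X n))).stronglyMeasurable

theorem IsMarkov.integrable_hist [IsFiniteMeasure P] (hX : M.IsMarkov P X) (n : ℕ)
    (φ : (Finset.Iic n → Q) → ℝ) : Integrable (fun ω => φ (hist X n ω)) P := by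
  have : Integrable φ (P.map (hist X n)) := .of_finite
  exact this.comp_measurable (measurable_hist hX n)

theorem IsMarkov.condExp_step [IsFiniteMeasure P] (hX : M.IsMarkov P X) (n : ℕ)
    (Φ : (Finset.Iic n → Q) → Q → ℝ) :
    P[fun ω => Φ (hist X n ω) (X (n + 1) ω) | hX.filtration n] =ᵐ[P]
      fun ω => ∑ r, M.prob (X n ω) r * Φ (hist X n ω) r := by
  classical
  symm
  have hsm := hX.stronglyMeasurable_hist n fun h => ∑ r, M.prob (last h) r * Φ h r
  have hint := hX.integrable_hist n fun h => ∑ r, M.prob (last h) r * Φ h r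
  refine ae_eq_condExp_of_forall_setIntegral_eq (hX.filtration.le n) ?_
    (fun s _ _ => hint.integrableOn) ?_ hsm.aestronglyMeasurable
  · exact hX.integrable_hist (n + 1) fun h => Φ (fun i => h ⟨i, Finset.mem_Iic.2
      ((Finset.mem_Iic.1 i.2).trans n.le_succ)⟩) (last h)
  · rintro s ⟨B, hB, rfl⟩ -
    have hm : MeasurableSet (hist X n ⁻¹' B) := measurable_hist hX n hB
    rw [← integral_indicator hm, ← integral_indicator hm]
    -- Membership in `B` is a property of the history, so it can be absorbed into `Φ`.
    have := hX.integral_step n fun h r => if h ∈ B then Φ h r else 0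
    refine Eq.trans ?_ (this.symm.trans ?_)
    · refine integral_congr_ae (.of_forall fun ω => ?_)
      by_cases hω : hist X n ω ∈ B <;> simp [Set.indicator, hω]
    · refine integral_congr_ae (.of_forall fun ω => ?_)
      by_cases hω : hist X n ω ∈ B <;> simp [Set.indicator, hω]

end MarkovChain

/-! ### The path measure as a Markov chain -/

namespace MarkovChain

variable {Q A : Type*} (M : MarkovChain Q A)
  [Finite Q] [MeasurableSpace Q] [DiscreteMeasurableSpace Q]

/-- The chain that has the transitions of `M` and starts in state `q`. -/
noncomputable def startAt (q : Q) : MarkovChain Q A := ⟨PMF.pure q, M.trans, M.label⟩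

instance (q : Q) : IsProbabilityMeasure (M.pathMeasure q) := by
  unfold pathMeasure
  infer_instance

theorem pathMeasure_map_zero (q : Q) :
    (M.pathMeasure q).map (fun x => x 0) = Measure.dirac q := by
  have h0 : (fun x : ℕ → Q => x 0) =
      (fun h : (Finset.Iic 0 → Q) => h ⟨0, Finset.mem_Iic.2 le_rfl⟩) ∘
        Preorder.frestrictLe (π := fun _ => Q) 0 := rfl
  rw [h0, ← Measure.map_map (measurable_pi_apply _) (by fun_prop), pathMeasure,
    Kernel.trajMeasure, Measure.map_comp _ _ (by fun_prop), Kernel.traj_map_frestrictLe,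
    Kernel.partialTraj_self, Measure.id_comp, Measure.map_map (measurable_pi_apply _) (by fun_prop)]
  exact Measure.map_id

/-- Expected return times are integrals against `pathMeasure`; this makes the one-step formulas
available for them. -/
theorem isMarkov_pathMeasure (q : Q) :
    (M.startAt q).IsMarkov (M.pathMeasure q) (fun i (x : ℕ → Q) => x i) where
  measurable i := measurable_pi_apply i
  law n y := by
    have hset : ∀ n, {x : ℕ → Q | ∀ i ≤ n, x i = y i} =
        Preorder.frestrictLe (π := fun _ => Q) n ⁻¹' {Preorder.frestrictLe n y} := by
      intro n
      ext x
      simp [funext_iff]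
    induction n with
    | zero =>
      have h0 : {x : ℕ → Q | ∀ i ≤ 0, x i = y i} = (fun x => x 0) ⁻¹' {y 0} := by
        ext x; simp
      rw [h0, ← Measure.map_apply (measurable_pi_apply 0) (measurableSet_singleton _),
        pathMeasure_map_zero, Measure.dirac_apply' _ (measurableSet_singleton _)]
      classical
      simp [startAt, Set.indicator, PMF.pure_apply, eq_comm]
    | succ n ih =>
      have hs : {x : ℕ → Q | ∀ i ≤ n + 1, x i = y i} =
          (fun x : ℕ → Q => (Preorder.frestrictLe (π := fun _ => Q) n x, x (n + 1))) ⁻¹'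
            ({Preorder.frestrictLe n y} ×ˢ {y (n + 1)}) := by
        ext x
        simp only [Set.mem_ofPred_eq, Set.mem_preimage, Set.mem_prod, Set.mem_singleton_iff]
        rw [show Preorder.frestrictLe (π := fun _ => Q) n x = Preorder.frestrictLe n y ↔
          ∀ i ≤ n, x i = y i by simp [funext_iff]]
        constructor
        · exact fun H => ⟨fun i hi => H i (by omega), H _ le_rfl⟩
        · rintro ⟨H, H'⟩ i hi
          rcases Nat.le_succ_iff.1 hi with hi | rfl
          exacts [H i hi, H']
      have hm : MeasurableSet ({Preorder.frestrictLe (π := fun _ => Q) n y} ×ˢ {y (n + 1)}) :=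
        (measurableSet_singleton _).prod (measurableSet_singleton _)
      rw [hs, ← Measure.map_apply (by fun_prop) hm]
      have := Kernel.map_frestrictLe_trajMeasure_compProd_eq_map_trajMeasure
        (X := fun _ => Q) (κ := M.stepKernel) (μ₀ := Measure.dirac q) (a := n)
      rw [pathMeasure, ← this, Measure.compProd_apply_prod (measurableSet_singleton _)
        (measurableSet_singleton _), lintegral_singleton,
        Measure.map_apply (by fun_prop) (measurableSet_singleton _), ← hset, ← pathMeasure, ih,
        Finset.prod_range_succ]
      have hk : M.stepKernel n (Preorder.frestrictLe (π := fun _ => Q) n y) {y (n + 1)} =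
          M.trans (y n) (y (n + 1)) := by
        simp only [stepKernel, transKernel, Kernel.comap_apply]
        exact PMF.toMeasure_apply_singleton _ _ (measurableSet_singleton _)
      rw [hk]
      simp only [startAt]
      ring

end MarkovChain

/-! ### Hitting times, return times and the Poisson equation -/

namespace MarkovChain

variable {Q A : Type*} (M : MarkovChain Q A) [Fintype Q]

open Classical in
/-- The probability that the chain started in the given state does not visit `q` up to
time `n`. -/
noncomputable def avoidProb (q : Q) : ℕ → Q → ℝ≥0∞
  | 0, x => if x = q then 0 else 1
  | n + 1, x => if x = q then 0 else ∑ y, M.trans x y * avoidProb q n y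

/-- The expected time of the first visit to `q`. -/
noncomputable def hittingTime (q x : Q) : ℝ≥0∞ := ∑' n, M.avoidProb q n x

theorem avoidProb_startAt (x q : Q) (n : ℕ) :
    (M.startAt x).avoidProb q n = M.avoidProb q n := by
  induction n with
  | zero => rfl
  | succ n ih => simp only [avoidProb, ih]; rfl

theorem avoidProb_self (q : Q) (n : ℕ) : M.avoidProb q n q = 0 := by
  cases n <;> simp [avoidProb]

theorem avoidProb_zero {q x : Q} (h : x ≠ q) : M.avoidProb q 0 x = 1 := by simp [avoidProb, h]

theorem avoidProb_succ {q x : Q} (h : x ≠ q) (n : ℕ) :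
    M.avoidProb q (n + 1) x = ∑ y, M.trans x y * M.avoidProb q n y := by simp [avoidProb, h]

theorem avoidProb_le_one (q : Q) (n : ℕ) (x : Q) : M.avoidProb q n x ≤ 1 := by
  induction n generalizing x with
  | zero => unfold avoidProb; split_ifs <;> simp
  | succ n ih =>
    by_cases h : x = q
    · simp [h, avoidProb_self]
    · rw [M.avoidProb_succ h, ← M.sum_trans x]
      exact Finset.sum_le_sum fun y _ => mul_le_of_le_one_right' (ih y)

theorem avoidProb_succ_le (q : Q) (n : ℕ) (x : Q) :
    M.avoidProb q (n + 1) x ≤ M.avoidProb q n x := by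
  induction n generalizing x with
  | zero =>
    by_cases h : x = q
    · simp [h, avoidProb_self]
    · rw [M.avoidProb_zero h]
      exact M.avoidProb_le_one q _ x
  | succ n ih =>
    by_cases h : x = q
    · simp [h, avoidProb_self]
    · rw [M.avoidProb_succ h, M.avoidProb_succ h]
      gcongr with y
      exact ih y

theorem avoidProb_antitone (q x : Q) : Antitone fun n => M.avoidProb q n x :=
  antitone_nat_of_succ_le fun n => M.avoidProb_succ_le q n x

theorem avoidProb_add_le {q : Q} {m : ℕ} {s : ℝ≥0∞} (hs : ∀ y, M.avoidProb q m y ≤ s) (n : ℕ)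
    (x : Q) : M.avoidProb q (m + n) x ≤ s * M.avoidProb q n x := by
  induction n generalizing x with
  | zero =>
    by_cases h : x = q
    · simp [h, avoidProb_self]
    · simpa [M.avoidProb_zero h] using hs x
  | succ n ih =>
    by_cases h : x = q
    · simp [h, avoidProb_self]
    · rw [← add_assoc, M.avoidProb_succ h, M.avoidProb_succ h, Finset.mul_sum]
      refine Finset.sum_le_sum fun y _ => ?_
      rw [mul_left_comm]
      gcongr
      exact ih y

variable {M}

/-- Induction along a path to `q`, from its end: a positive-probability step to a state from which
`q` may be hit leaves a positive chance of hitting `q`. -/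
theorem Connected.exists_avoidProb_lt_one (hM : M.Connected) (q x : Q) :
    ∃ n, M.avoidProb q n x < 1 := by
  induction hM x q using Relation.ReflTransGen.head_induction_on with
  | refl => exact ⟨0, by simp [avoidProb_self]⟩
  | @head x z hxz _ ih =>
    obtain ⟨n, hn⟩ := ih
    refine ⟨n + 1, ?_⟩
    by_cases h : x = q
    · simp [h, avoidProb_self]
    · rw [M.avoidProb_succ h]
      have hsum : ∑ y, M.trans x y * M.avoidProb q n y +
          ∑ y, M.trans x y * (1 - M.avoidProb q n y) = 1 := by
        rw [← Finset.sum_add_distrib]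
        refine (Finset.sum_congr rfl fun y _ => ?_).trans (M.sum_trans x)
        rw [← mul_add, add_tsub_cancel_of_le (M.avoidProb_le_one q n y), mul_one]
      have hne : ∑ y, M.trans x y * (1 - M.avoidProb q n y) ≠ 0 := by
        intro h0
        have := (Finset.sum_eq_zero_iff.1 h0) z (Finset.mem_univ _)
        rcases mul_eq_zero.1 this with h1 | h1
        · exact hxz h1
        · exact absurd (tsub_eq_zero_iff_le.1 h1) (not_le.2 hn)
      rw [← hsum]
      refine ENNReal.lt_add_right (fun htop => ?_) hne
      rw [htop] at hsum
      simp at hsum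

/-- By finiteness, one `N` and one `c < 1` bound the avoidance probability from every start, so
avoidance decays geometrically in blocks of length `N`. -/
theorem Connected.hittingTime_ne_top (hM : M.Connected) (q x : Q) : M.hittingTime q x ≠ ∞ := by
  choose n hn using hM.exists_avoidProb_lt_one q
  set N := Finset.univ.sup n with hN
  have hlt : ∀ y, M.avoidProb q N y < 1 := fun y =>
    (M.avoidProb_antitone q y (Finset.le_sup (f := n) (Finset.mem_univ y))).trans_lt (hn y)
  have : Nonempty Q := ⟨q⟩
  obtain ⟨z, hz⟩ := Finite.exists_max (M.avoidProb q N)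
  set c := M.avoidProb q N z
  have hc : c < 1 := hlt z
  have hc' : 1 - c ≠ 0 := (tsub_pos_of_lt hc).ne'
  have hpart : ∀ T, ∑ i ∈ Finset.range T, M.avoidProb q i x ≤ N / (1 - c) := by
    intro T
    set S := ∑ i ∈ Finset.range T, M.avoidProb q i x with hS
    have hStop : S ≠ ∞ := ENNReal.sum_ne_top.2 fun i _ =>
      ((M.avoidProb_le_one q i x).trans_lt ENNReal.one_lt_top).ne
    -- Split off the first block and contract the rest; as `S` is finite, this can be solved for
    -- `S`.
    have h1 : S ≤ N + c * S := by
      calc S ≤ ∑ i ∈ Finset.range (N + T), M.avoidProb q i x :=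
            Finset.sum_le_sum_of_subset (Finset.range_mono (by omega))
        _ = ∑ i ∈ Finset.range N, M.avoidProb q i x +
            ∑ i ∈ Finset.range T, M.avoidProb q (N + i) x := Finset.sum_range_add _ _ _
        _ ≤ ∑ i ∈ Finset.range N, 1 + ∑ i ∈ Finset.range T, c * M.avoidProb q i x := by
            gcongr with i _ i _
            · exact M.avoidProb_le_one q i x
            · exact M.avoidProb_add_le hz i x
        _ = N + c * S := by simp [Finset.mul_sum, hS]
    rw [ENNReal.le_div_iff_mul_le (.inl hc') (.inl (by simp)),
      ENNReal.mul_sub (fun _ _ => hStop), mul_one, tsub_le_iff_right, mul_comm S c]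
    exact h1
  refine ((ENNReal.tsum_le_of_sum_range_le hpart).trans_lt ?_).ne
  exact ENNReal.div_lt_top (ENNReal.natCast_ne_top N) hc'

variable (M)

theorem hittingTime_self (q : Q) : M.hittingTime q q = 0 := by
  simp [hittingTime, avoidProb_self]

theorem sum_trans_mul_hittingTime (q x : Q) :
    ∑ y, M.trans x y * M.hittingTime q y = ∑' n, ∑ y, M.trans x y * M.avoidProb q n y := by
  rw [Summable.tsum_finsetSum fun _ _ => ENNReal.summable]
  simp [hittingTime, ENNReal.tsum_mul_left]

theorem hittingTime_eq {q x : Q} (h : x ≠ q) :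
    M.hittingTime q x = 1 + ∑ y, M.trans x y * M.hittingTime q y := by
  rw [sum_trans_mul_hittingTime, hittingTime, tsum_eq_zero_add' ENNReal.summable, M.avoidProb_zero h]
  simp_rw [M.avoidProb_succ h]

-- The layer-cake identity `T = ∑ 1{T > n}`, which turns the expected return time into a sum of
-- avoidance probabilities.
open Classical in
theorem returnTime_eq_tsum {Q : Type*} (q : Q) (x : ℕ → Q) :
    returnTime q x = ∑' n : ℕ, if ∀ i, 1 ≤ i → i ≤ n → x i ≠ q then 1 else 0 := by
  by_cases h : ∃ n, 1 ≤ n ∧ x n = q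
  · have hN := Nat.find_spec h
    have hmin : ∀ n, 1 ≤ n → x n = q → Nat.find h ≤ n := fun n h1 h2 => Nat.find_min' h ⟨h1, h2⟩
    set N := Nat.find h
    have h1 : returnTime q x = N :=
      le_antisymm (iInf₂_le N hN) (le_iInf₂ fun n hn => by exact_mod_cast hmin n hn.1 hn.2)
    have h2 : ∀ n, (∀ i, 1 ≤ i → i ≤ n → x i ≠ q) ↔ n < N := by
      intro n
      constructor
      · intro H
        by_contra hlt
        exact H N hN.1 (not_lt.1 hlt) hN.2
      · intro H i hi hin hx
        exact absurd (hmin i hi hx) (by omega)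
    simp_rw [h1, h2]
    rw [tsum_eq_sum (s := Finset.range N) fun n hn => if_neg (by simpa using hn)]
    rw [Finset.sum_congr rfl fun n hn => if_pos (Finset.mem_range.1 hn)]
    simp
  · have h1 : returnTime q x = ∞ := by
      refine iInf₂_eq_top.2 fun n hn => absurd ⟨n, hn⟩ h
    have h2 : ∀ n, (∀ i, 1 ≤ i → i ≤ n → x i ≠ q) := fun n i hi _ hx => h ⟨i, hi, hx⟩
    rw [h1]
    exact ((tsum_congr fun n => if_pos (h2 n)).trans
      (ENNReal.tsum_const_eq_top_of_ne_zero one_ne_zero)).symm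

variable [MeasurableSpace Q] [DiscreteMeasurableSpace Q]

-- Each induction step trades one step of the actual path for one step of the recursion of
-- `avoidProb`; the condition at time `m + 1` is free, since `avoidProb` vanishes at `q`.
variable {M} in
open Classical in
theorem IsMarkov.lintegral_avoid {Ω : Type*} [MeasurableSpace Ω] {P : Measure Ω} {X : ℕ → Ω → Q}
    (hX : M.IsMarkov P X) (q : Q) (m n : ℕ) :
    ∫⁻ ω, (if ∀ i, 1 ≤ i → i ≤ m → X i ω ≠ q then 1 else 0) * M.avoidProb q n (X (m + 1) ω) ∂P =
      ∫⁻ ω, ∑ y, M.trans (X 0 ω) y * M.avoidProb q (m + n) y ∂P := by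
  induction m generalizing n with
  | zero =>
    have := hX.lintegral_step 0 fun _ r => M.avoidProb q n r
    rw [zero_add 1, zero_add n]
    refine Eq.trans ?_ this
    refine lintegral_congr fun ω => ?_
    rw [if_pos (fun i h1 h2 => by omega), one_mul]
  | succ m ih =>
    have := hX.lintegral_step (m + 1) fun h r =>
      (if ∀ i (_ : 1 ≤ i) (hi : i ≤ m + 1), h ⟨i, Finset.mem_Iic.2 hi⟩ ≠ q then 1 else 0) *
        M.avoidProb q n r
    refine this.trans ?_
    rw [show m + 1 + n = m + (n + 1) by omega, ← ih (n + 1)]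
    refine lintegral_congr fun ω => ?_
    change ∑ y, M.trans (X (m + 1) ω) y *
      ((if ∀ i, 1 ≤ i → i ≤ m + 1 → X i ω ≠ q then 1 else 0) * M.avoidProb q n y) = _
    have hiff : (∀ i, 1 ≤ i → i ≤ m + 1 → X i ω ≠ q) ↔
        (∀ i, 1 ≤ i → i ≤ m → X i ω ≠ q) ∧ X (m + 1) ω ≠ q := by
      constructor
      · exact fun H => ⟨fun i h1 h2 => H i h1 (by omega), H _ (by omega) le_rfl⟩
      · rintro ⟨H, H'⟩ i h1 h2
        rcases Nat.le_succ_iff.1 h2 with h2 | rfl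
        exacts [H i h1 h2, H']
    by_cases hq : X (m + 1) ω = q
    · rw [hq, avoidProb_self, mul_zero]
      refine Finset.sum_eq_zero fun y _ => ?_
      rw [if_neg (fun H => H (m + 1) (by omega) le_rfl hq)]
      simp
    · rw [M.avoidProb_succ hq, Finset.mul_sum]
      refine Finset.sum_congr rfl fun y _ => ?_
      rw [mul_left_comm]
      congr 1
      split_ifs with h1 h2 h2
      exacts [rfl, absurd (hiff.1 h1).1 h2, absurd (hiff.2 ⟨h2, hq⟩) h1, rfl]

theorem expectedReturnTime_eq (q : Q) :
    M.expectedReturnTime q = 1 + ∑ y, M.trans q y * M.hittingTime q y := by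
  classical
  have hX := M.isMarkov_pathMeasure q
  have h0 : ∀ᵐ x ∂M.pathMeasure q, x 0 = q := by
    have h1 : ∀ᵐ z ∂(M.pathMeasure q).map (fun x => x 0), z = q := by
      rw [pathMeasure_map_zero]
      exact (ae_dirac_iff (measurableSet_singleton q)).2 rfl
    exact ae_of_ae_map (measurable_pi_apply 0).aemeasurable h1
  have hmeas : ∀ n, Measurable fun x : ℕ → Q =>
      if ∀ i, 1 ≤ i → i ≤ n → x i ≠ q then (1 : ℝ≥0∞) else 0 := by
    intro n
    refine Measurable.ite ?_ measurable_const measurable_const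
    simp_rw [measurableSet_setOfPred]
    refine Measurable.forall fun i => Measurable.imp measurable_const
      (Measurable.imp measurable_const (Measurable.not ?_))
    exact measurableSet_setOfPred.1
      (measurable_pi_apply (X := fun _ : ℕ => Q) i (measurableSet_singleton q))
  rw [expectedReturnTime, lintegral_congr fun x => returnTime_eq_tsum q x,
    lintegral_tsum fun n => (hmeas n).aemeasurable, tsum_eq_zero_add' ENNReal.summable,
    sum_trans_mul_hittingTime]
  congr 1
  · refine (lintegral_congr (g := fun _ => 1) fun x => if_pos fun i h1 h2 => by omega).trans ?_
    simp
  · congr 1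
    ext n
    have := hX.lintegral_avoid q n 0
    refine Eq.trans (lintegral_congr fun x => ?_) (this.trans ?_)
    · by_cases hq : x (n + 1) = q
      · rw [hq, avoidProb_self, if_neg (fun H => H (n + 1) (by omega) le_rfl hq), mul_zero]
      · rw [avoidProb_zero _ hq, mul_one]
        split_ifs with h1 h2 h2
        · rfl
        · exact absurd (fun i hi hin => h1 i hi (by omega)) h2
        · refine absurd (fun i hi hin => ?_) h1
          rcases Nat.le_succ_iff.1 hin with hin | rfl
          exacts [h2 i hi hin, hq]
        · rfl
    · rw [lintegral_congr_ae (g := fun _ => ∑ y, M.trans q y * M.avoidProb q n y)]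
      · simp
      · filter_upwards [h0] with x hx
        rw [hx, add_zero]
        simp only [avoidProb_startAt]
        rfl

variable {M}

-- First-step analysis: off `q` the hitting time drops by 1 on average per step, while at `q` the
-- next step leads to mean hitting time `m_q - 1`. Scaling by `-f_q` makes the two constants agree.
open Classical in
theorem Connected.exists_poisson_indicator (hM : M.Connected) (q : Q) :
    ∃ h : Q → ℝ, ∀ x, (if x = q then 1 else 0) + ∑ y, M.prob x y * h y - h x = M.stateFreq q := by
  have hsum : ∀ x, (∑ y, M.trans x y * M.hittingTime q y).toReal =
      ∑ y, M.prob x y * (M.hittingTime q y).toReal := by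
    intro x
    rw [ENNReal.toReal_sum fun y _ =>
      ENNReal.mul_ne_top ((M.trans x).apply_ne_top y) (hM.hittingTime_ne_top q y)]
    simp [prob]
  have htop : ∀ x, ∑ y, M.trans x y * M.hittingTime q y ≠ ∞ := fun x =>
    ENNReal.sum_ne_top.2 fun y _ =>
      ENNReal.mul_ne_top ((M.trans x).apply_ne_top y) (hM.hittingTime_ne_top q y)
  have hq : (M.stateFreq q)⁻¹ = 1 + ∑ y, M.prob q y * (M.hittingTime q y).toReal := by
    rw [stateFreq, ENNReal.toReal_inv, inv_inv, M.expectedReturnTime_eq,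
      ENNReal.toReal_add ENNReal.one_ne_top (htop q), hsum, ENNReal.toReal_one]
  have hpos : 0 < (M.stateFreq q)⁻¹ := by
    rw [hq]
    have := Finset.sum_nonneg fun y (_ : y ∈ Finset.univ) =>
      mul_nonneg (M.prob_nonneg q y) (M.hittingTime q y).toReal_nonneg
    linarith
  have hne : M.stateFreq q ≠ 0 := (inv_pos.1 hpos).ne'
  refine ⟨fun x => -(M.stateFreq q * (M.hittingTime q x).toReal), fun x => ?_⟩
  have hs : ∑ y, M.prob x y * -(M.stateFreq q * (M.hittingTime q y).toReal) =
      -(M.stateFreq q * ∑ y, M.prob x y * (M.hittingTime q y).toReal) := by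
    rw [Finset.mul_sum, ← Finset.sum_neg_distrib]
    exact Finset.sum_congr rfl fun y _ => by ring
  simp only [hs]
  by_cases h : x = q
  · subst h
    rw [if_pos rfl, hittingTime_self, ← sub_eq_iff_eq_add'.2 hq]
    field_simp
    simp
  · rw [if_neg h, M.hittingTime_eq h, ENNReal.toReal_add ENNReal.one_ne_top (htop x), hsum,
      ENNReal.toReal_one]
    ring

/-- The Poisson equation of a finite connected chain is solvable; its constant is the mean of the
function with respect to the state frequencies. -/
theorem Connected.exists_poisson (hM : M.Connected) (g : Q → ℝ) :
    ∃ h : Q → ℝ, ∀ x, g x + ∑ y, M.prob x y * h y - h x = ∑ q, M.stateFreq q * g q := by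
  classical
  choose h hh using hM.exists_poisson_indicator
  refine ⟨fun x => ∑ q, g q * h q x, fun x => ?_⟩
  have : ∀ q, M.stateFreq q * g q = g q * ((if x = q then 1 else 0) + ∑ y, M.prob x y * h q y -
      h q x) := fun q => by rw [hh q x, mul_comm]
  simp_rw [this, mul_sub, mul_add, Finset.sum_sub_distrib, Finset.sum_add_distrib]
  congr 2
  · simp
  · simp_rw [Finset.mul_sum]
    rw [Finset.sum_comm]
    exact Finset.sum_congr rfl fun q _ => Finset.sum_congr rfl fun y _ => by ring

end MarkovChain

/-! ### Signs of partial sums along the chain -/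

namespace MarkovChain

/-- The sum of `g` over all states of a history but the last. -/
def histSum {Q : Type*} (g : Q → ℝ) {n : ℕ} (h : Finset.Iic n → Q) : ℝ :=
  ∑ i : Fin n, g (h ⟨i, Finset.mem_Iic.2 i.2.le⟩)

theorem histSum_hist {Q Ω : Type*} (g : Q → ℝ) (X : ℕ → Ω → Q) (n : ℕ) (ω : Ω) :
    histSum g (hist X n ω) = ∑ i ∈ Finset.range n, g (X i ω) :=
  (Finset.sum_range fun i => g (X i ω)).symm

open Filter Topology

variable {Q A Ω : Type*} {M : MarkovChain Q A} [Fintype Q] [MeasurableSpace Q]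
  [DiscreteMeasurableSpace Q] [MeasurableSpace Ω] {P : Measure Ω} {X : ℕ → Ω → Q}

/-- A Chernoff bound: the corrector `h` makes the conditional factor of each step at most `ρ`
uniformly in the current state. -/
theorem IsMarkov.lintegral_exp_le (hX : M.IsMarkov P X) (g h : Q → ℝ) (θ ρ : ℝ)
    (hρ : ∀ x, ∑ y, M.prob x y * Real.exp (-(θ * (g x + h y - h x))) ≤ ρ) (n : ℕ) :
    ∫⁻ ω, ENNReal.ofReal (Real.exp (-(θ * (∑ i ∈ Finset.range n, g (X i ω) + h (X n ω))))) ∂P ≤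
      ENNReal.ofReal ρ ^ n * ∫⁻ ω, ENNReal.ofReal (Real.exp (-(θ * h (X 0 ω)))) ∂P := by
  induction n with
  | zero => simp
  | succ n ih =>
    have hstep := hX.lintegral_step n fun k r =>
      ENNReal.ofReal (Real.exp (-(θ * (histSum g k + g (last k) + h r))))
    simp only [histSum_hist] at hstep
    simp_rw [Finset.sum_range_succ]
    refine hstep.trans_le ?_
    rw [pow_succ', mul_assoc]
    refine le_trans ?_ (mul_le_mul_right ih (ENNReal.ofReal ρ))
    rw [← lintegral_const_mul' _ _ ENNReal.ofReal_ne_top]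
    refine lintegral_mono fun ω => ?_
    have hb := hρ (X n ω)
    have e : ∀ r, M.trans (X n ω) r * ENNReal.ofReal (Real.exp (-(θ *
        (∑ i ∈ Finset.range n, g (X i ω) + g (X n ω) + h r)))) =
        ENNReal.ofReal (Real.exp (-(θ * (∑ i ∈ Finset.range n, g (X i ω) + h (X n ω)))) *
          (M.prob (X n ω) r * Real.exp (-(θ * (g (X n ω) + h r - h (X n ω)))))) := by
      intro r
      rw [mul_left_comm, ← Real.exp_add, ENNReal.ofReal_mul (M.prob_nonneg _ _), prob,
        ENNReal.ofReal_toReal ((M.trans _).apply_ne_top _)]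
      congr 3
      ring
    change ∑ r, M.trans (X n ω) r * ENNReal.ofReal (Real.exp (-(θ *
        (∑ i ∈ Finset.range n, g (X i ω) + g (X n ω) + h r)))) ≤ _
    rw [Finset.sum_congr rfl fun r _ => e r, ← ENNReal.ofReal_sum_of_nonneg fun r _ =>
      mul_nonneg (Real.exp_nonneg _) (mul_nonneg (M.prob_nonneg _ _) (Real.exp_nonneg _)),
      ← Finset.mul_sum, ENNReal.ofReal_mul (Real.exp_nonneg _), mul_comm]
    gcongr

/-- If `g` has positive mean with respect to the state frequencies, then its partial sums along the
chain are almost surely eventually positive. -/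
theorem IsMarkov.ae_eventually_sum_pos [IsProbabilityMeasure P] (hX : M.IsMarkov P X)
    (hM : M.Connected) (g : Q → ℝ) (hg : 0 < ∑ q, M.stateFreq q * g q) :
    ∀ᵐ ω ∂P, ∀ᶠ n in atTop, 0 < ∑ i ∈ Finset.range n, g (X i ω) := by
  obtain ⟨h, hh⟩ := hM.exists_poisson g
  set m := ∑ q, M.stateFreq q * g q
  obtain ⟨c₀, hc₀⟩ := (Set.finite_range fun z : Q × Q => |g z.1 + h z.2 - h z.1|).bddAbove
  obtain ⟨C, hC⟩ := (Set.finite_range h).bddAbove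
  set c := max c₀ 1
  have hc1 : 1 ≤ c := le_max_right _ _
  have hc : ∀ x y, |g x + h y - h x| ≤ c := fun x y =>
    (hc₀ ⟨(x, y), rfl⟩).trans (le_max_left _ _)
  -- The first bound keeps the exponent in `[-1, 1]`, where `exp u ≤ 1 + u + u²`; the second makes
  -- the quadratic error at most half of the drift `θ m`.
  set θ := min (1 / c) (m / (2 * c ^ 2))
  have hθ : 0 < θ := lt_min (by positivity) (by positivity)
  have hθ1 : θ * c ≤ 1 := by
    have := min_le_left (1 / c) (m / (2 * c ^ 2))
    rwa [le_div_iff₀ (by positivity)] at this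
  have hθ2 : θ * c ^ 2 ≤ m / 2 := by
    have := min_le_right (1 / c) (m / (2 * c ^ 2))
    rw [le_div_iff₀ (by positivity)] at this
    linarith
  have hρ : ∀ x, ∑ y, M.prob x y * Real.exp (-(θ * (g x + h y - h x))) ≤ 1 - θ * m / 2 := by
    intro x
    have hmean : ∑ y, M.prob x y * (g x + h y - h x) = m := by
      simp_rw [mul_sub, mul_add, Finset.sum_sub_distrib, Finset.sum_add_distrib, ← Finset.sum_mul,
        M.sum_prob, one_mul]
      exact hh x
    calc ∑ y, M.prob x y * Real.exp (-(θ * (g x + h y - h x)))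
        ≤ ∑ y, M.prob x y * (1 - θ * (g x + h y - h x) + (θ * c) ^ 2) := by
          refine Finset.sum_le_sum fun y _ => mul_le_mul_of_nonneg_left ?_ (M.prob_nonneg x y)
          have h1 : |-(θ * (g x + h y - h x))| ≤ θ * c := by
            rw [abs_neg, abs_mul, abs_of_pos hθ]
            exact mul_le_mul_of_nonneg_left (hc x y) hθ.le
          have h2 := (abs_le.1 (Real.abs_exp_sub_one_sub_id_le (h1.trans hθ1))).2
          have h3 := sq_le_sq' (abs_le.1 h1).1 (abs_le.1 h1).2
          linarith
      _ = 1 - θ * m + (θ * c) ^ 2 := by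
          have e : ∀ y, M.prob x y * (1 - θ * (g x + h y - h x) + (θ * c) ^ 2) =
              M.prob x y * (1 + (θ * c) ^ 2) - θ * (M.prob x y * (g x + h y - h x)) :=
            fun y => by ring
          rw [Finset.sum_congr rfl fun y _ => e y, Finset.sum_sub_distrib, ← Finset.sum_mul,
            ← Finset.mul_sum, hmean, M.sum_prob]
          ring
      _ ≤ 1 - θ * m / 2 := by nlinarith
  have hle := hX.lintegral_exp_le g h θ _ hρ
  set Z : ℕ → Ω → ℝ≥0∞ := fun n ω =>
    ENNReal.ofReal (Real.exp (-(θ * (∑ i ∈ Finset.range n, g (X i ω) + h (X n ω)))))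
  have hZ : ∀ n, Measurable (Z n) := by
    intro n
    have hm : ∀ f : Q → ℝ, ∀ i, Measurable fun ω => f (X i ω) := fun f i =>
      (measurable_of_countable f).comp (hX.measurable i)
    exact ENNReal.measurable_ofReal.comp (Real.measurable_exp.comp
      (((Finset.measurable_fun_sum _ fun i _ => hm g i).add (hm h n)).const_mul θ).neg)
  have hI : ∫⁻ ω, ENNReal.ofReal (Real.exp (-(θ * h (X 0 ω)))) ∂P ≠ ∞ := by
    refine ne_top_of_le_ne_top (b := ∑ q, ENNReal.ofReal (Real.exp (-(θ * h q))))
      (ENNReal.sum_ne_top.2 fun _ _ => ENNReal.ofReal_ne_top) ?_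
    refine (lintegral_mono fun ω => Finset.single_le_sum (f := fun q =>
      ENNReal.ofReal (Real.exp (-(θ * h q)))) (fun _ _ => zero_le) (Finset.mem_univ (X 0 ω))).trans ?_
    simp
  have hsum : ∫⁻ ω, ∑' n, Z n ω ∂P ≠ ∞ := by
    rw [lintegral_tsum fun n => (hZ n).aemeasurable]
    refine ne_top_of_le_ne_top ?_ (ENNReal.tsum_le_tsum hle)
    rw [ENNReal.tsum_mul_right, ENNReal.tsum_geometric]
    refine ENNReal.mul_ne_top (ENNReal.inv_ne_top.2 (tsub_pos_of_lt ?_).ne') hI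
    rw [ENNReal.ofReal_lt_one]
    have := mul_pos hθ hg
    linarith
  -- Summability forces `Z n → 0`; once `Z n < exp (-θ C)`, the sum plus `h (X n)` exceeds `C ≥ h (X
  -- n)`.
  filter_upwards [ae_lt_top (Measurable.tsum hZ) hsum] with ω hω
  have hlim := ENNReal.tendsto_atTop_zero_of_tsum_ne_top hω.ne
  filter_upwards [hlim.eventually (gt_mem_nhds (ENNReal.ofReal_pos.2 (Real.exp_pos (-(θ * C)))))]
    with n hn
  have h1 := (ENNReal.ofReal_lt_ofReal_iff (Real.exp_pos _)).1 hn
  have h2 := lt_of_mul_lt_mul_left (neg_lt_neg_iff.1 (Real.exp_lt_exp.1 h1)) hθ.le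
  have h3 : h (X n ω) ≤ C := hC ⟨_, rfl⟩
  linarith

/-- Almost surely, a transition of positive probability from a state that is visited infinitely
often is taken infinitely often. -/
theorem IsMarkov.ae_frequently_transition_of_frequently [IsProbabilityMeasure P]
    (hX : M.IsMarkov P X) {s t : Q} (hst : M.trans s t ≠ 0) :
    ∀ᵐ ω ∂P, (∃ᶠ n in atTop, X n ω = s) → ∃ᶠ n in atTop, X n ω = s ∧ X (n + 1) ω = t := by
  classical
  -- The transition is indexed by its arrival time so that `E n` is known at time `n`, as the
  -- conditional Borel–Cantelli lemma requires; `1 ≤ n` guards the truncated subtraction.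
  let E : ℕ → Set Ω := fun n => {ω | 1 ≤ n ∧ X (n - 1) ω = s ∧ X n ω = t}
  have hE : ∀ n, MeasurableSet[hX.filtration n] (E n) := by
    intro n
    refine ⟨{k | ∃ h : 1 ≤ n, k ⟨n - 1, Finset.mem_Iic.2 (by omega)⟩ = s ∧ last k = t},
      Set.toFinite _ |>.measurableSet, ?_⟩
    ext ω
    simp [E, hist, last, and_assoc]
  have hcond : ∀ n, P[(E (n + 1)).indicator (1 : Ω → ℝ) | hX.filtration n] =ᵐ[P]
      fun ω => if X n ω = s then M.prob s t else 0 := by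
    intro n
    have h1 := hX.condExp_step n fun k r => if last k = s ∧ r = t then (1 : ℝ) else 0
    have h2 : (E (n + 1)).indicator (1 : Ω → ℝ) = fun ω =>
        if last (hist X n ω) = s ∧ X (n + 1) ω = t then (1 : ℝ) else 0 := by
      ext ω
      simp only [E, Set.indicator, last, hist, Set.mem_ofPred_eq]
      congr 1
      simp
    rw [h2]
    refine h1.trans (.of_forall fun ω => ?_)
    by_cases hs : X n ω = s <;> simp [last, hist, hs]
  filter_upwards [ae_mem_limsup_atTop_iff P hE, ae_all_iff.2 hcond] with ω hω hc hfreq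
  have hmem : ω ∈ limsup E atTop := by
    rw [hω]
    simp_rw [hc]
    have h3 : ω ∈ limsup (fun n => {ω | X n ω = s}) atTop :=
      mem_limsup_iff_frequently_mem.2 hfreq
    rw [Set.limsup_eq_tendsto_sum_indicator_atTop (M.prob_pos hst)] at h3
    simpa [Set.indicator] using h3
  have h4 := mem_limsup_iff_frequently_mem.1 hmem
  rw [frequently_atTop] at h4 ⊢
  intro a
  obtain ⟨b, hb, h1, h2, h3⟩ := h4 (a + 1)
  refine ⟨b - 1, by omega, h2, ?_⟩
  rwa [Nat.sub_add_cancel h1]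

theorem IsMarkov.ae_frequently_transition [IsProbabilityMeasure P]
    (hX : M.IsMarkov P X) (hM : M.Connected) :
    ∀ᵐ ω ∂P, (∀ s, ∃ᶠ n in atTop, X n ω = s) ∧
      ∀ s t, M.trans s t ≠ 0 → ∃ᶠ n in atTop, X n ω = s ∧ X (n + 1) ω = t := by
  have h : ∀ᵐ ω ∂P, ∀ s t, M.trans s t ≠ 0 → (∃ᶠ n in atTop, X n ω = s) →
      ∃ᶠ n in atTop, X n ω = s ∧ X (n + 1) ω = t := by
    simp_rw [ae_all_iff]
    exact fun s t hst => hX.ae_frequently_transition_of_frequently hst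
  filter_upwards [h] with ω hω
  -- Pigeonhole gives one recurrent state; connectedness spreads recurrence to all others.
  obtain ⟨s₀, hs₀⟩ : ∃ s, ∃ᶠ n in atTop, X n ω = s := by
    by_contra! hcon
    simp_rw [← eventually_all] at hcon
    obtain ⟨n, hn⟩ := hcon.exists
    exact hn _ rfl
  have hall : ∀ s, ∃ᶠ n in atTop, X n ω = s := by
    intro s
    induction hM s₀ s with
    | refl => exact hs₀
    | tail _ hst ih =>
      have := hω _ _ hst ih
      rw [frequently_atTop] at this ⊢
      intro a
      obtain ⟨b, hb, -, h2⟩ := this a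
      exact ⟨b + 1, by omega, h2⟩
  exact ⟨hall, fun s t hst => hω s t hst (hall s)⟩

theorem IsMarkov.ae_trans_ne_zero (hX : M.IsMarkov P X) :
    ∀ᵐ ω ∂P, ∀ n, M.trans (X n ω) (X (n + 1) ω) ≠ 0 := by
  classical
  refine ae_all_iff.2 fun n => ?_
  have h := hX.lintegral_step n fun k r => if M.trans (last k) r = 0 then 1 else 0
  have h0 : ∫⁻ ω, ∑ r, M.trans (X n ω) r *
      (if M.trans (last (hist X n ω)) r = 0 then 1 else 0) ∂P = 0 := by
    refine (lintegral_congr fun ω => Finset.sum_eq_zero fun r _ => ?_).trans lintegral_zero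
    change M.trans (X n ω) r * (if M.trans (X n ω) r = 0 then 1 else 0) = 0
    split_ifs with h1 <;> simp [h1]
  have hm : Measurable fun ω =>
      (if M.trans (X n ω) (X (n + 1) ω) = 0 then 1 else 0 : ℝ≥0∞) :=
    (measurable_of_countable fun z : Q × Q => (if M.trans z.1 z.2 = 0 then 1 else 0 : ℝ≥0∞)).comp
      ((hX.measurable n).prodMk (hX.measurable (n + 1)))
  filter_upwards [(lintegral_eq_zero_iff hm).1 (h.trans h0)] with ω hω h1
  simp [h1] at hω

/-- If `g` has nonpositive mean with respect to the state frequencies, then its partial sums along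
the chain are almost surely infinitely often nonpositive. -/
theorem IsMarkov.ae_frequently_sum_nonpos [IsProbabilityMeasure P] (hX : M.IsMarkov P X)
    (hM : M.Connected) (g : Q → ℝ) (hg : ∑ q, M.stateFreq q * g q ≤ 0) :
    ∀ᵐ ω ∂P, ∃ᶠ n in atTop, ∑ i ∈ Finset.range n, g (X i ω) ≤ 0 := by
  obtain ⟨h, hh⟩ := hM.exists_poisson g
  set m := ∑ q, M.stateFreq q * g q
  obtain ⟨c, hc⟩ := (Set.finite_range fun z : Q × Q => |g z.1 + h z.2 - h z.1 - m|).bddAbove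
  obtain ⟨C, hC⟩ := (Set.finite_range h).bddBelow
  let Y : ℕ → Ω → ℝ := fun n ω => ∑ i ∈ Finset.range n, g (X i ω) + h (X n ω) - n * m
  have hYf : ∀ n, Y n = fun ω => (fun k => histSum g k + h (last k) - n * m) (hist X n ω) := by
    intro n
    ext ω
    simp only [histSum_hist, Y]
    rfl
  have hdiff : ∀ n ω, Y (n + 1) ω - Y n ω = g (X n ω) + h (X (n + 1) ω) - h (X n ω) - m := by
    intro n ω
    simp only [Y, Finset.sum_range_succ]
    push_cast
    ring
  have hmart : Martingale Y hX.filtration P := by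
    refine martingale_of_condExp_sub_eq_zero_nat (fun n => ?_) (fun n => ?_) fun n => ?_
    · rw [hYf]
      exact hX.stronglyMeasurable_hist n fun k => histSum g k + h (last k) - n * m
    · rw [hYf]
      exact hX.integrable_hist n fun k => histSum g k + h (last k) - n * m
    · have h1 := hX.condExp_step n fun k r => g (last k) + h r - h (last k) - m
      have h2 : Y (n + 1) - Y n = fun ω =>
          g (last (hist X n ω)) + h (X (n + 1) ω) - h (last (hist X n ω)) - m := by
        ext ω
        exact hdiff n ω
      rw [h2]
      refine h1.trans (.of_forall fun ω => ?_)
      change ∑ r, M.prob (X n ω) r * (g (X n ω) + h r - h (X n ω) - m) = 0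
      simp_rw [mul_sub, mul_add, Finset.sum_sub_distrib, Finset.sum_add_distrib, ← Finset.sum_mul,
        M.sum_prob, one_mul]
      rw [hh, sub_self]
  have hbdd : ∀ᵐ ω ∂P, ∀ i, |Y (i + 1) ω - Y i ω| ≤ c.toNNReal := by
    refine .of_forall fun ω i => ?_
    rw [hdiff]
    exact (hc ⟨(X i ω, X (i + 1) ω), rfl⟩).trans (Real.le_coe_toNNReal c)
  filter_upwards [hmart.bddAbove_range_iff_bddBelow_range hbdd,
    hmart.submartingale.bddAbove_iff_exists_tendsto hbdd, hX.ae_frequently_transition hM,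
    hX.ae_trans_ne_zero] with ω h1 h2 h3 h4
  by_contra hcon
  rw [not_frequently] at hcon
  -- Were `S_n` eventually positive, `Y n` would eventually be at least `C`, since `-n m ≥ 0`.
  -- Bounded increments then give an upper bound and convergence.
  have hbelow : BddBelow (Set.range fun n => Y n ω) := by
    refine (isBoundedUnder_of_eventually_ge (a := C) ?_).bddBelow_range
    filter_upwards [hcon] with n hn
    have h6 : C ≤ h (X n ω) := hC ⟨_, rfl⟩
    have h5 : (n : ℝ) * m ≤ 0 := mul_nonpos_of_nonneg_of_nonpos n.cast_nonneg hg
    simp only [Y]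
    linarith [not_le.1 hn]
  obtain ⟨l, hl⟩ := h2.1 (h1.2 hbelow)
  have hlim : Tendsto (fun n => Y (n + 1) ω - Y n ω) atTop (𝓝 0) := by
    simpa using (hl.comp (tendsto_add_atTop_nat 1)).sub hl
  -- The increment depends only on the transition taken, and each possible transition recurs;
  -- increments tending to 0 must therefore vanish.
  have hzero : ∀ s t, M.trans s t ≠ 0 → g s + h t - h s - m = 0 := by
    intro s t hst
    by_contra hne
    have hev := hlim.eventually_ne (Ne.symm hne)
    obtain ⟨n, ⟨rfl, rfl⟩, hn⟩ := ((h3.2 s t hst).and_eventually hev).exists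
    exact hn (hdiff n ω)
  have hconst : ∀ n, Y n ω = h (X 0 ω) := by
    intro n
    induction n with
    | zero => simp [Y]
    | succ n ih => rw [← ih, ← sub_eq_zero, hdiff, hzero _ _ (h4 n)]
  -- At a late return to the initial state the `h` terms cancel, leaving `S_n = n m ≤ 0`.
  obtain ⟨n, hn0, hn⟩ := ((h3.1 (X 0 ω)).and_eventually hcon).exists
  have h5 : (n : ℝ) * m ≤ 0 := mul_nonpos_of_nonneg_of_nonpos n.cast_nonneg hg
  have h6 := hconst n
  simp only [Y, hn0] at h6
  exact hn (by linarith)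

end MarkovChain

/-! ### Combinatorics of the mode -/

theorem IsMode.unique {A : Type*} {u : List A} {a b : A} (ha : IsMode u a) (hb : IsMode u b) :
    a = b := by
  by_contra h
  exact lt_asymm (ha b (Ne.symm h)) (hb a h)

theorem modeStatistic_eq_some_iff {A : Type*} {u : List A} {a : A} :
    modeStatistic A u = some a ↔ IsMode u a := by
  unfold modeStatistic
  constructor
  · intro h
    split_ifs at h with hex
    rw [← Option.some.inj h]
    exact hex.choose_spec
  · intro h
    rw [dif_pos ⟨a, h⟩]
    exact congrArg some (IsMode.unique (Exists.choose_spec (p := IsMode u) ⟨a, h⟩) h)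

theorem wordPrefix_succ {A : Type*} (w : ℕ → A) (n : ℕ) :
    wordPrefix w (n + 1) = wordPrefix w n ++ [w n] := by
  simp [wordPrefix, List.range_succ]

open Classical in
theorem count_wordPrefix {A : Type*} (w : ℕ → A) (n : ℕ) (a : A) :
    (wordPrefix w n).count a = ∑ i ∈ Finset.range n, if w i = a then 1 else 0 := by
  induction n with
  | zero => simp [wordPrefix]
  | succ n ih =>
    rw [wordPrefix_succ, List.count_append, ih, Finset.sum_range_succ, List.count_singleton]
    simp

/-- Over a finite alphabet, infinitely many prefixes of every infinite word have a mode. -/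
theorem exists_ge_isMode {A : Type*} [Finite A] (w : ℕ → A) (N : ℕ) :
    ∃ n ≥ N, ∃ a, IsMode (wordPrefix w n) a := by
  classical
  have := Fintype.ofFinite A
  by_contra! hcon
  -- The first letter whose count exceeds `N` would be a mode at that moment. Without modes all
  -- counts stay at most `N`, yet they add up to the length.
  have hbound : ∀ n ≥ N, ∀ a, ∑ i ∈ Finset.range n, (if w i = a then 1 else 0) ≤ N := by
    intro n hn
    induction n, hn using Nat.le_induction with
    | base =>
      intro a
      refine (Finset.sum_le_sum fun i _ => (?_ : _ ≤ 1)).trans (by simp)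
      split_ifs <;> simp
    | succ n hn ih =>
      intro a
      by_contra! hlt
      refine hcon (n + 1) (by omega) a fun b hb => ?_
      rw [count_wordPrefix, count_wordPrefix]
      refine lt_of_le_of_lt ?_ hlt
      have ha := ih a
      rw [Finset.sum_range_succ] at hlt ⊢
      have hwa : w n = a := by
        by_contra hne
        rw [if_neg hne] at hlt
        omega
      rw [if_neg (hwa ▸ Ne.symm hb), add_zero]
      exact ih b
  have htotal : ∀ n, ∑ a, ∑ i ∈ Finset.range n, (if w i = a then 1 else 0) = n := by
    intro n
    rw [Finset.sum_comm]
    simp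
  have h1 := htotal (N + Fintype.card A * N + 1)
  have h2 := Finset.sum_le_sum fun a (_ : a ∈ Finset.univ) =>
    hbound (N + Fintype.card A * N + 1) (by omega) a
  rw [h1] at h2
  simp at h2

/-- If the mode statistic converges to no letter, then its value changes infinitely often. -/
theorem exists_ge_modeStatistic_ne {A : Type*} [Finite A] {w : ℕ → A}
    (hw : ¬ ∃ c : A, (modeStatistic A).ConvergesOn w (some c)) (n : ℕ) :
    ∃ m ≥ n, modeStatistic A (wordPrefix w (m + 1)) ≠ modeStatistic A (wordPrefix w m) := by
  by_contra! hcon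
  obtain ⟨k, hk, c, hc⟩ := exists_ge_isMode w n
  refine hw ⟨c, k, fun m hm => ?_⟩
  induction m, hm using Nat.le_induction with
  | base => exact modeStatistic_eq_some_iff.2 hc
  | succ m hm ih => rw [hcon m (by omega), ih]

/-! ### From partial sums to the mode statistic -/

namespace MarkovChain

open Filter

variable {Q A Ω : Type*} {M : MarkovChain Q A}

open Classical in
/-- The difference of the indicator functions of two letters, as a function of the state. -/
noncomputable def letterDiff (M : MarkovChain Q A) (a b : A) (q : Q) : ℝ :=
  (if M.label q = a then 1 else 0) - (if M.label q = b then 1 else 0)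

open Classical in
theorem isMode_wordPrefix_iff (X : ℕ → Ω → Q) (ω : Ω) (n : ℕ) (a : A) :
    IsMode (wordPrefix (M.word X ω) n) a ↔
      ∀ b, b ≠ a → 0 < ∑ i ∈ Finset.range n, M.letterDiff a b (X i ω) := by
  refine forall₂_congr fun b _ => ?_
  simp only [letterDiff]
  rw [count_wordPrefix, count_wordPrefix, Finset.sum_sub_distrib, sub_pos, ← Nat.cast_lt (α := ℝ)]
  push_cast
  rfl

variable [Fintype Q] [MeasurableSpace Q] [DiscreteMeasurableSpace Q]

theorem sum_stateFreq_mul_letterDiff (a b : A) :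
    ∑ q, M.stateFreq q * M.letterDiff a b q = M.letterFreq a - M.letterFreq b := by
  classical
  simp only [letterDiff, letterFreq, mul_sub, Finset.sum_sub_distrib, mul_ite, mul_one, mul_zero,
    Finset.sum_filter]

variable [MeasurableSpace Ω] {P : Measure Ω} [IsProbabilityMeasure P] {X : ℕ → Ω → Q}

theorem IsMarkov.ae_not_convergesOn_modeStatistic (hX : M.IsMarkov P X) (hM : M.Connected)
    {a b : A} (hab : b ≠ a) (hle : M.letterFreq a ≤ M.letterFreq b) :
    ∀ᵐ ω ∂P, ¬ (modeStatistic A).ConvergesOn (M.word X ω) (some a) := by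
  filter_upwards [hX.ae_frequently_sum_nonpos hM (M.letterDiff a b)
    (by rw [sum_stateFreq_mul_letterDiff]; linarith)] with ω hω
  rintro ⟨n, hn⟩
  obtain ⟨m, hm, h⟩ := frequently_atTop.1 hω n
  have := (isMode_wordPrefix_iff X ω m a).1 (modeStatistic_eq_some_iff.1 (hn m hm)) b hab
  exact h.not_gt this

theorem IsMarkov.statisticConverges_modeStatistic [Finite A] (hX : M.IsMarkov P X)
    (hM : M.Connected) {a : A} (ha : ∀ b, b ≠ a → M.letterFreq b < M.letterFreq a) :
    M.StatisticConverges P X (modeStatistic A) (some a) := by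
  have h : ∀ᵐ ω ∂P, ∀ b, b ≠ a →
      ∀ᶠ n in atTop, 0 < ∑ i ∈ Finset.range n, M.letterDiff a b (X i ω) := by
    refine ae_all_iff.2 fun b => ?_
    by_cases hb : b = a
    · simp [hb]
    · filter_upwards [hX.ae_eventually_sum_pos hM (M.letterDiff a b)
        (by rw [sum_stateFreq_mul_letterDiff]; linarith [ha b hb])] with ω hω _ using hω
  refine h.mono fun ω hω => ?_
  have hev : ∀ᶠ n in atTop, ∀ b, b ≠ a →
      0 < ∑ i ∈ Finset.range n, M.letterDiff a b (X i ω) := by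
    simpa only [eventually_all, eventually_imp_distrib_left] using hω
  obtain ⟨n, hn⟩ := eventually_atTop.1 hev
  exact ⟨n, fun m hm => modeStatistic_eq_some_iff.2 ((isMode_wordPrefix_iff X ω m a).2 (hn m hm))⟩

end MarkovChain

theorem mainTheorem5 {Q A Ω : Type*} [Fintype Q] [MeasurableSpace Q]
    [DiscreteMeasurableSpace Q] [Finite A] [MeasurableSpace Ω]
    (M : MarkovChain Q A) (hM : M.Connected)
    (P : Measure Ω) [IsProbabilityMeasure P] (X : ℕ → Ω → Q) (hX : M.IsMarkov P X) :
    (∀ a : A, M.StatisticConverges P X (modeStatistic A) (some a) ↔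
      ∀ b, b ≠ a → M.letterFreq b < M.letterFreq a) ∧
    (∀ a a' : A, a ≠ a' → M.letterFreq a = M.letterFreq a' →
      (∀ b, M.letterFreq b ≤ M.letterFreq a) →
      ∀ᵐ ω ∂P,
        (∀ n, ∃ m ≥ n, modeStatistic A (wordPrefix (M.word X ω) (m + 1)) ≠
          modeStatistic A (wordPrefix (M.word X ω) m)) ∧
        ¬ ∃ c : A, (modeStatistic A).ConvergesOn (M.word X ω) (some c)) := by
  refine ⟨fun a => ⟨fun h b hb => ?_, hX.statisticConverges_modeStatistic hM⟩,
    fun a a' hne heq hmax => ?_⟩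
  · by_contra! hle
    have hnot := hX.ae_not_convergesOn_modeStatistic hM hb hle
    obtain ⟨ω, h1, h2⟩ := (Filter.Eventually.and h hnot).exists
    exact h2 h1
  · have hnot : ∀ᵐ ω ∂P, ∀ c : A, ¬ (modeStatistic A).ConvergesOn (M.word X ω) (some c) := by
      refine ae_all_iff.2 fun c => ?_
      -- Each letter needs a different competitor of at least its frequency: `a'` for `a`, and `a`
      -- for every other letter.
      by_cases hc : c = a
      · subst hc
        exact hX.ae_not_convergesOn_modeStatistic hM hne.symm heq.le
      · exact hX.ae_not_convergesOn_modeStatistic hM (Ne.symm hc) (hmax c)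
    filter_upwards [hnot] with ω hω
    have hw := not_exists.2 hω
    exact ⟨exists_ge_modeStatistic_ne hw, hw⟩
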